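/- Let $f:\mathbb{R}^{d_1}\times\mathbb{R}^{d_2}\to\mathbb{R}$ be $B$-bounded ($|f|\le B$), $G$-Lipschitz, $L$-gradient Lipschitz (differentiable with $\|\nabla f(w_1)-\nabla f(w_2)\|\le L\|w_1-w_2\|$) and $\rho$-Hessian Lipschitz (twice differentiable with $\|\nabla^2 f(w_1)-\nabla^2 f(w_2)\|\le\rho\|w_1-w_2\|$), where $\|\cdot\|$ is the Euclidean norm for vectors and the operator norm for matrices. Let $k\ge 1$ and let $\mathcal{A}_1,\dots,\mathcal{A}_k:\mathbb{R}^{d_1}\times\mathbb{R}^{\ell}\to\mathbb{R}^{d_2}$ be measurable in the seed and, for every fixed seed $\zeta\in\mathbb{R}^{\ell}$, differentiable in $x$ with $\|\mathcal{A}_i(x_1,\zeta)-\mathcal{A}_i(x_2,\zeta)\|\le G'\|x_1-x_2\|$ and $\|D\mathcal{A}_i(x_1,\zeta)-D\mathcal{A}_i(x_2,\zeta)\|\le L'\|x_1-x_2\|$, where $D$ is the Jacobian in $x$. Let $z=(z_1,\dots,z_k)$ be independent random seeds in $\mathbb{R}^{\ell}$ with arbitrary laws $\nu_1,\dots,\nu_k$,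 and put $$g_{z,i}(x)=f(x,\mathcal{A}_i(x,z_i)),\qquad g(x)=\mathbb{E}_z\Big[\max_{1\le i\le k} g_{z,i}(x)\Big].$$ Set $\widehat L=L(1+G')^2+GL'$ and $\widehat G=G(1+G')$, and assume that both are positive. Let $$g_{1/(2\widehat L)}(x)=\min_{x'\in\mathbb{R}^{d_1}}\big(g(x')+\widehat L\|x-x'\|^2\big)$$ be the Moreau envelope of $g$ with parameter $1/(2\widehat L)$; this minimum is attained for every $x$, and $g_{1/(2\widehat L)}$ is differentiable. Stochastic subgradient descent with initial point $x_0\in\mathbb{R}^{d_1}$ and step size $\eta$ does the following for $s=0,\dots,S$. It draws fresh seeds $z=(z_1,\dots,z_k)$, independent of all earlier steps; it chooses arbitrary weights $\lambda_i\ge 0$ with $\sum_i\lambda_i=1$ and with $\lambda_i=0$ unless $g_{z,i}(x_s)=\max_j g_{z,j}(x_s)$ (the choice may depend measurably on the present seeds, on the past, and on additional randomness, as long as later seeds remain fresh); and it sets $x_{s+1}=x_s-\eta\sum_i\lambda_i\nabla g_{z,i}(x_s)$. It outputs $\bar x=x_s$ with $s$ uniform on $\{0,\dots,S\}$ and independent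 of the iterates. Let $\epsilon>0$, let $S\in\mathbb{N}$ satisfy $S\ge 32\,B\,\widehat L\,\widehat G^2\,\epsilon^{-4}$, and let $\eta=\big(2B/[\widehat L\,\widehat G^2\,(S+1)]\big)^{1/2}$. Then, for every $x_0$, the output $\bar x$ satisfies $$\mathbb{E}\big[\|\nabla g_{1/(2\widehat L)}(\bar x)\|^2\big]\le\epsilon^2 .$$ -/

import Mathlib

open MeasureTheory ProbabilityTheory

noncomputable section

namespace MinimaxSGD

/-- `ℝ^d` with the Euclidean norm. -/
abbrev E (d : ℕ) : Type := EuclideanSpace ℝ (Fin d)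

/-- `ℝ^{d₁} × ℝ^{d₂}` with the Euclidean norm of the concatenated vector `w = (x, y)`. -/
abbrev EProd (d₁ d₂ : ℕ) : Type := WithLp 2 (E d₁ × E d₂)

/-- The objective `f` is `B`-bounded, `G`-Lipschitz, `L`-gradient Lipschitz and `ρ`-Hessian
Lipschitz. The Hessian at `w` is the derivative at `w` of the gradient, and carries the operator
norm. -/
structure SmoothObjective {d₁ d₂ : ℕ} (f : EProd d₁ d₂ → ℝ) (B G L ρ : ℝ) : Prop where
  bounded : ∀ w, |f w| ≤ B
  lipschitz : ∀ w₁ w₂, |f w₁ - f w₂| ≤ G * ‖w₁ - w₂‖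
  differentiable : Differentiable ℝ f
  gradient_lipschitz : ∀ w₁ w₂, ‖gradient f w₁ - gradient f w₂‖ ≤ L * ‖w₁ - w₂‖
  twice_differentiable : Differentiable ℝ (gradient f)
  hessian_lipschitz : ∀ w₁ w₂,
    ‖fderiv ℝ (gradient f) w₁ - fderiv ℝ (gradient f) w₂‖ ≤ ρ * ‖w₁ - w₂‖

/-- The algorithm `𝒜(x, z)` (input `x`, random seed `z`) is `G'`-Lipschitz and `L'`-gradient
Lipschitz in `x`, for every seed. The Jacobian `D𝒜(x, z)` is the derivative in `x`, with the
operator norm. -/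
structure SmoothAlgorithm {d₁ d₂ l : ℕ} (A : E d₁ → E l → E d₂) (G' L' : ℝ) : Prop where
  lipschitz : ∀ z x₁ x₂, ‖A x₁ z - A x₂ z‖ ≤ G' * ‖x₁ - x₂‖
  differentiable : ∀ z, Differentiable ℝ (fun x => A x z)
  jacobian_lipschitz : ∀ z x₁ x₂,
    ‖fderiv ℝ (fun x => A x z) x₁ - fderiv ℝ (fun x => A x z) x₂‖ ≤ L' * ‖x₁ - x₂‖

section Problem

variable {d₁ d₂ l k : ℕ}

/-- `g_{z,i}(x) = f(x, 𝒜_i(x, z_i))`. -/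
def sampleObj (f : EProd d₁ d₂ → ℝ) (A : Fin k → E d₁ → E l → E d₂)
    (z : Fin k → E l) (i : Fin k) (x : E d₁) : ℝ :=
  f (WithLp.toLp 2 (x, A i x (z i)))

/-- `g(x) = 𝔼_z [max_i f(x, 𝒜_i(x, z_i))]`, where the seeds `z_i ∼ ν_i` are independent. -/
def robustObj (f : EProd d₁ d₂ → ℝ) (A : Fin k → E d₁ → E l → E d₂)
    (ν : Fin k → Measure (E l)) (x : E d₁) : ℝ :=
  ∫ z, (⨆ i, sampleObj f A z i x) ∂(Measure.pi ν)

/-- The Moreau envelope `g_γ(x) = min_{x'} g(x') + (2γ)⁻¹ ‖x - x'‖²`. -/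
def moreauEnvelope (g : E d₁ → ℝ) (γ : ℝ) (x : E d₁) : ℝ :=
  ⨅ x' : E d₁, (g x' + (2 * γ)⁻¹ * ‖x - x'‖ ^ 2)

/-- `c` is a vector of weights in the probability simplex that is supported on
`argmax_i g_{z,i}(x)`. -/
def IsArgmaxWeight (f : EProd d₁ d₂ → ℝ) (A : Fin k → E d₁ → E l → E d₂)
    (z : Fin k → E l) (x : E d₁) (c : Fin k → ℝ) : Prop :=
  c ∈ stdSimplex ℝ (Fin k) ∧
    ∀ i, c i ≠ 0 → ∀ j, sampleObj f A z j x ≤ sampleObj f A z i x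

/-- The stochastic subgradient `∑_i c_i ∇g_{z,i}(x)`. -/
def stochSubgradient (f : EProd d₁ d₂ → ℝ) (A : Fin k → E d₁ → E l → E d₂)
    (z : Fin k → E l) (x : E d₁) (c : Fin k → ℝ) : E d₁ :=
  ∑ i, c i • gradient (sampleObj f A z i) x

/-- A run, on the probability space `(Ω, P)`, of stochastic subgradient descent with steps
`s = 0, …, S`, initial point `x₀` and step size `η`: `z s` are the seeds sampled at step `s`, `c s`
the weights used there (any measurable choice, possibly randomized and possibly depending on the
present seeds and on the past), `x s` the iterates, and `x (τ)` the output. -/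
structure IsSGDRun {Ω : Type*} [MeasurableSpace Ω] (P : Measure Ω)
    (f : EProd d₁ d₂ → ℝ) (A : Fin k → E d₁ → E l → E d₂) (ν : Fin k → Measure (E l))
    (S : ℕ) (x₀ : E d₁) (η : ℝ)
    (z : ℕ → Ω → Fin k → E l) (c : ℕ → Ω → Fin k → ℝ) (x : ℕ → Ω → E d₁) (τ : Ω → ℕ) :
    Prop where
  measurable_seed : ∀ s, Measurable (z s)
  measurable_weight : ∀ s, Measurable (c s)
  /-- The seeds `z_1, …, z_k` of a step are independent with laws `ν_1, …, ν_k`. -/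
  law_seed : ∀ s ≤ S, P.map (z s) = Measure.pi ν
  /-- The seeds of a step are fresh: independent of everything used in the earlier steps. -/
  fresh_seed : ∀ s ≤ S, IndepFun (z s) (fun ω (r : Fin s) => (z r ω, c r ω)) P
  init : ∀ ω, x 0 ω = x₀
  weight : ∀ s ≤ S, ∀ ω, IsArgmaxWeight f A (z s ω) (x s ω) (c s ω)
  step : ∀ s ≤ S, ∀ ω,
    x (s + 1) ω = x s ω - η • stochSubgradient f A (z s ω) (x s ω) (c s ω)
  measurable_index : Measurable τ
  /-- The output index is uniform on `{0, …, S}`. -/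
  index_mem : ∀ ω, τ ω ≤ S
  index_uniform : ∀ s ≤ S, P {ω | τ ω = s} = ((S : ENNReal) + 1)⁻¹
  /-- The output index is independent of the iterates. -/
  index_indep : IndepFun τ (fun ω (s : Fin (S + 1)) => x s ω) P

end Problem

end MinimaxSGD

end

/-! Write K for `Lhat`. Each sampled objective has a K-Lipschitz gradient. A maximum of such
functions need not be differentiable, but it remains K-weakly convex (in Mathlib's terms,
`StrongConvexOn` with modulus `-K`), and so does its expectation g. Adding K‖x - ·‖² makes g
strongly convex with modulus K, so proximal points exist, grow quadratically
(`prox_quadratic_growth`) and depend on x in a Lipschitz way. Hence the Moreau envelope φ is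
differentiable with ∇φ(x) = 2K(x - p), where p is the proximal point of x
(`hasGradientAt_moreauEnvelope`).

The envelope is the Lyapunov function. Testing φ at the next iterate with the old proximal point p
leaves an inner product of the stochastic subgradient with p - x (`moreauEnvelope_step_le`). Weak
convexity bounds it by the sampled max at p minus the sampled max at x, plus (K/2)‖p - x‖². Fresh
seeds turn this difference into g(p) - g(x) in expectation, and `prox_decrease` converts that into
-‖∇φ(x)‖²/(4K). Telescoping with |φ| ≤ B, and choosing η to balance the two error terms, bounds the
average over the iterates, which is the expectation at the uniformly drawn output. -/

noncomputable section

namespace MinimaxSGD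

/-! ### Weak convexity and the chain rule for Lipschitz derivatives. -/

section Smooth

variable {V W : Type*} [NormedAddCommGroup V] [InnerProductSpace ℝ V]
  [NormedAddCommGroup W] [InnerProductSpace ℝ W]

/-- A function whose derivative is `K`-Lipschitz lies above its quadratic lower models. -/
lemma quadratic_lower_bound {F : V → ℝ} {K : ℝ} (hF : Differentiable ℝ F)
    (hlip : ∀ x y, ‖fderiv ℝ F x - fderiv ℝ F y‖ ≤ K * ‖x - y‖) (x y : V) :
    F x + fderiv ℝ F x (y - x) - K / 2 * ‖y - x‖ ^ 2 ≤ F y := by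
  set d := y - x with hd
  set ψ : ℝ → ℝ := fun t => F (x + t • d) - t * fderiv ℝ F x d + K / 2 * t ^ 2 * ‖d‖ ^ 2 with hψ
  have hder : ∀ t : ℝ, HasDerivAt ψ
      (fderiv ℝ F (x + t • d) d - fderiv ℝ F x d + K * t * ‖d‖ ^ 2) t := by
    intro t
    have h1 : HasDerivAt (fun t : ℝ => x + t • d) d t := by
      simpa using ((hasDerivAt_id t).smul_const d).const_add x
    have h2 : HasDerivAt (fun t : ℝ => F (x + t • d)) (fderiv ℝ F (x + t • d) d) t :=
      (hF (x + t • d)).hasFDerivAt.comp_hasDerivAt t h1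
    have h3 : HasDerivAt (fun t : ℝ => t * fderiv ℝ F x d) (fderiv ℝ F x d) t := by
      simpa using (hasDerivAt_id t).mul_const (fderiv ℝ F x d)
    have h4 : HasDerivAt (fun t : ℝ => K / 2 * t ^ 2 * ‖d‖ ^ 2) (K * t * ‖d‖ ^ 2) t := by
      refine (((hasDerivAt_pow 2 t).const_mul (K / 2)).mul_const (‖d‖ ^ 2)).congr_deriv ?_
      push_cast; ring
    exact (h2.sub h3).add h4
  -- The quadratic in `ψ` compensates the largest possible drift of the directional derivative along
  -- the segment, so `ψ` increases from F x to the desired bound.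
  have hmono : MonotoneOn ψ (Set.Icc 0 1) := by
    refine monotoneOn_of_deriv_nonneg (convex_Icc 0 1)
      (fun t _ => (hder t).continuousAt.continuousWithinAt)
      (fun t _ => (hder t).differentiableAt.differentiableWithinAt) fun t ht => ?_
    rw [interior_Icc] at ht
    rw [(hder t).deriv]
    have h1 : ‖(fderiv ℝ F (x + t • d) - fderiv ℝ F x) d‖ ≤ K * ‖x + t • d - x‖ * ‖d‖ :=
      ((fderiv ℝ F (x + t • d) - fderiv ℝ F x).le_opNorm d).trans
        (mul_le_mul_of_nonneg_right (hlip _ _) (norm_nonneg d))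
    rw [add_sub_cancel_left, norm_smul, Real.norm_of_nonneg ht.1.le, Real.norm_eq_abs] at h1
    have h2 := neg_abs_le ((fderiv ℝ F (x + t • d) - fderiv ℝ F x) d)
    rw [sub_apply] at h1 h2
    nlinarith
  have h := hmono (Set.left_mem_Icc.2 zero_le_one) (Set.right_mem_Icc.2 zero_le_one) zero_le_one
  have hy : x + d = y := by simp [hd]
  simp only [hψ, zero_smul, add_zero, one_smul, hy] at h
  linarith

/-- Both endpoints are compared with the model based at the convex combination: the weighted
displacements sum to zero, so the linear terms cancel, and the quadratic ones add up to ab(K/2)‖x -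
y‖². -/
lemma strongConvexOn_neg_of_lower_bound {F : V → ℝ} {F' : V → V →L[ℝ] ℝ} {K : ℝ}
    (h : ∀ x y, F x + F' x (y - x) - K / 2 * ‖y - x‖ ^ 2 ≤ F y) :
    StrongConvexOn Set.univ (-K) F := by
  refine ⟨convex_univ, fun x _ y _ a b ha hb hab => ?_⟩
  have hx := h (a • x + b • y) x
  have hy := h (a • x + b • y) y
  obtain rfl : a = 1 - b := by linarith
  have e1 : x - ((1 - b) • x + b • y) = b • (x - y) := by module
  have e2 : y - ((1 - b) • x + b • y) = (-(1 - b)) • (x - y) := by module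
  rw [e1, map_smul, norm_smul, Real.norm_eq_abs, mul_pow, sq_abs] at hx
  rw [e2, map_smul, norm_smul, Real.norm_eq_abs, mul_pow, sq_abs] at hy
  simp only [smul_eq_mul] at hx hy ⊢
  have := add_le_add (mul_le_mul_of_nonneg_left hx ha) (mul_le_mul_of_nonneg_left hy hb)
  nlinarith

/-- Weak convexity, unlike smoothness, survives the maximum over the algorithms; this is the
property carried from the samples to g. -/
lemma StrongConvexOn.iSup_fin {ι : Type*} [Finite ι] [Nonempty ι] {m : ℝ} {F : ι → V → ℝ}
    (hF : ∀ i, StrongConvexOn Set.univ m (F i)) :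
    StrongConvexOn Set.univ m (fun x => ⨆ i, F i x) := by
  refine ⟨convex_univ, fun x _ y _ a b ha hb hab => ciSup_le fun i => ?_⟩
  have hx := mul_le_mul_of_nonneg_left (le_ciSup (Set.finite_range fun i => F i x).bddAbove i) ha
  have hy := mul_le_mul_of_nonneg_left (le_ciSup (Set.finite_range fun i => F i y).bddAbove i) hb
  have := (hF i).2 (Set.mem_univ x) (Set.mem_univ y) ha hb hab
  simp only [smul_eq_mul] at this hx hy ⊢
  linarith

lemma StrongConvexOn.integral {α : Type*} [MeasurableSpace α] {μ : Measure α}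
    [IsProbabilityMeasure μ] {m : ℝ} {F : α → V → ℝ}
    (hF : ∀ z, StrongConvexOn Set.univ m (F z)) (hint : ∀ x, Integrable (fun z => F z x) μ) :
    StrongConvexOn Set.univ m (fun x => ∫ z, F z x ∂μ) := by
  refine ⟨convex_univ, fun x hx y hy a b ha hb hab => ?_⟩
  have h1 : Integrable (fun z => a * F z x + b * F z y) μ :=
    ((hint x).const_mul a).add ((hint y).const_mul b)
  have := integral_mono (hint (a • x + b • y))
    (h1.sub (integrable_const (a * b * (m / 2 * ‖x - y‖ ^ 2))))
    fun z => (hF z).2 hx hy ha hb hab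
  refine this.trans_eq ?_
  rw [integral_sub' h1 (integrable_const _),
    integral_add ((hint x).const_mul a) ((hint y).const_mul b)]
  simp [integral_const_mul]

lemma norm_le_norm_fst_add_norm_snd {V W : Type*} [SeminormedAddCommGroup V]
    [SeminormedAddCommGroup W] (w : WithLp 2 (V × W)) :
    ‖w‖ ≤ ‖w.fst‖ + ‖w.snd‖ := by
  refine abs_le_of_sq_le_sq' ?_ (by positivity) |>.2
  rw [WithLp.prod_norm_sq_eq_of_L2]
  nlinarith [norm_nonneg w.fst, norm_nonneg w.snd]

lemma norm_gradient [CompleteSpace V] (F : V → ℝ) (x : V) : ‖gradient F x‖ = ‖fderiv ℝ F x‖ :=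
  LinearIsometryEquiv.norm_map _ _

lemma norm_gradient_sub [CompleteSpace V] (F : V → ℝ) (x y : V) :
    ‖gradient F x - gradient F y‖ = ‖fderiv ℝ F x - fderiv ℝ F y‖ := by
  rw [gradient, gradient, ← map_sub, LinearIsometryEquiv.norm_map]

lemma hasFDerivAt_graph {a : V → W} {a' : V →L[ℝ] W} {x : V} (ha : HasFDerivAt a a' x) :
    HasFDerivAt (fun x => WithLp.toLp 2 (x, a x))
      ((WithLp.prodContinuousLinearEquiv 2 ℝ V W).symm.toContinuousLinearMap.comp
        ((ContinuousLinearMap.id ℝ V).prod a')) x :=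
  (WithLp.prodContinuousLinearEquiv 2 ℝ V W).symm.hasFDerivAt.comp x
    ((hasFDerivAt_id x).prodMk ha)

lemma norm_graph_sub_le {V W : Type*} [SeminormedAddCommGroup V] [SeminormedAddCommGroup W]
    {a : V → W} {K : ℝ} (ha : ∀ x y, ‖a x - a y‖ ≤ K * ‖x - y‖) (x y : V) :
    ‖WithLp.toLp 2 (x, a x) - WithLp.toLp 2 (y, a y)‖ ≤ (1 + K) * ‖x - y‖ := by
  refine (norm_le_norm_fst_add_norm_snd _).trans ?_
  have := ha x y
  rw [WithLp.sub_fst, WithLp.sub_snd, WithLp.toLp_fst, WithLp.toLp_fst, WithLp.toLp_snd,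
    WithLp.toLp_snd]
  linarith

lemma norm_fderiv_graph_le {a : V → W} {K : ℝ} (hK : 0 ≤ K)
    (ha : ∀ x y, ‖a x - a y‖ ≤ K * ‖x - y‖) (x : V) :
    ‖fderiv ℝ (fun x => WithLp.toLp 2 (x, a x)) x‖ ≤ 1 + K :=
  norm_fderiv_le_of_lip' ℝ (by positivity)
    (Filter.Eventually.of_forall fun y => norm_graph_sub_le ha y x)

/-- The identity component of the graph has constant derivative, so only the Jacobian of `a`
contributes: the constant is K and not 1 + K. -/
lemma norm_fderiv_graph_sub_le {a : V → W} {K : ℝ} (hK : 0 ≤ K) (ha : Differentiable ℝ a)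
    (hlip : ∀ x y, ‖fderiv ℝ a x - fderiv ℝ a y‖ ≤ K * ‖x - y‖) (x y : V) :
    ‖fderiv ℝ (fun x => WithLp.toLp 2 (x, a x)) x - fderiv ℝ (fun x => WithLp.toLp 2 (x, a x)) y‖
      ≤ K * ‖x - y‖ := by
  refine ContinuousLinearMap.opNorm_le_bound _ (by positivity) fun v => ?_
  rw [(hasFDerivAt_graph (ha x).hasFDerivAt).fderiv, (hasFDerivAt_graph (ha y).hasFDerivAt).fderiv]
  refine (norm_le_norm_fst_add_norm_snd _).trans ?_
  have h1 := ((fderiv ℝ a x - fderiv ℝ a y).le_opNorm v).trans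
    (mul_le_mul_of_nonneg_right (hlip x y) (norm_nonneg v))
  simpa using h1

lemma norm_fderiv_comp_le {f : W → ℝ} {h : V → W} {G H : ℝ} (hG : 0 ≤ G)
    (hf : Differentiable ℝ f) (hh : Differentiable ℝ h)
    (hDf : ∀ w, ‖fderiv ℝ f w‖ ≤ G) (hDh : ∀ x, ‖fderiv ℝ h x‖ ≤ H) (x : V) :
    ‖fderiv ℝ (fun x => f (h x)) x‖ ≤ G * H := by
  have hchain : fderiv ℝ (fun x => f (h x)) x = (fderiv ℝ f (h x)).comp (fderiv ℝ h x) :=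
    fderiv_comp x (hf _) (hh x)
  rw [hchain]
  exact (ContinuousLinearMap.opNorm_comp_le _ _).trans
    (mul_le_mul (hDf _) (hDh x) (norm_nonneg _) hG)

/-- The derivative of a composition is Lipschitz when both derivatives are. -/
lemma norm_fderiv_comp_sub_le {f : W → ℝ} {h : V → W} {G L H K : ℝ} (hG : 0 ≤ G) (hL : 0 ≤ L)
    (hH : 0 ≤ H) (hf : Differentiable ℝ f) (hh : Differentiable ℝ h)
    (hDf : ∀ w, ‖fderiv ℝ f w‖ ≤ G)
    (hDflip : ∀ w₁ w₂, ‖fderiv ℝ f w₁ - fderiv ℝ f w₂‖ ≤ L * ‖w₁ - w₂‖)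
    (hlip : ∀ x y, ‖h x - h y‖ ≤ H * ‖x - y‖) (hDh : ∀ x, ‖fderiv ℝ h x‖ ≤ H)
    (hDlip : ∀ x y, ‖fderiv ℝ h x - fderiv ℝ h y‖ ≤ K * ‖x - y‖) (x y : V) :
    ‖fderiv ℝ (fun x => f (h x)) x - fderiv ℝ (fun x => f (h x)) y‖ ≤
      (L * H ^ 2 + G * K) * ‖x - y‖ := by
  have hchain : ∀ x, fderiv ℝ (fun x => f (h x)) x = (fderiv ℝ f (h x)).comp (fderiv ℝ h x) :=
    fun x => fderiv_comp x (hf _) (hh x)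
  have e : fderiv ℝ (fun x => f (h x)) x - fderiv ℝ (fun x => f (h x)) y =
      (fderiv ℝ f (h x) - fderiv ℝ f (h y)).comp (fderiv ℝ h x) +
        (fderiv ℝ f (h y)).comp (fderiv ℝ h x - fderiv ℝ h y) := by
    rw [hchain, hchain]; ext v; simp
  rw [e]
  have h1 : ‖fderiv ℝ f (h x) - fderiv ℝ f (h y)‖ ≤ L * (H * ‖x - y‖) :=
    (hDflip _ _).trans (mul_le_mul_of_nonneg_left (hlip x y) hL)
  calc _ ≤ _ := norm_add_le _ _
    _ ≤ L * (H * ‖x - y‖) * H + G * (K * ‖x - y‖) :=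
      add_le_add
        ((ContinuousLinearMap.opNorm_comp_le _ _).trans
          (mul_le_mul h1 (hDh x) (norm_nonneg _) (by positivity)))
        ((ContinuousLinearMap.opNorm_comp_le _ _).trans
          (mul_le_mul (hDf _) (hDlip x y) (norm_nonneg _) hG))
    _ = _ := by ring

lemma continuous_section {f : WithLp 2 (V × W) → ℝ} (hf : Differentiable ℝ f) (x : V) :
    Continuous fun y => f (WithLp.toLp 2 (x, y)) :=
  hf.continuous.comp ((WithLp.prod_continuous_toLp 2 V W).comp (Continuous.prodMk_right x))

end Smooth

/-! ### Regularity of the sampled objectives, their maximum and its expectation. -/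

section Sample

variable {d₁ d₂ l k : ℕ} {f : EProd d₁ d₂ → ℝ} {A : Fin k → E d₁ → E l → E d₂}
  {B G L ρ G' L' : ℝ}

lemma differentiable_sampleObj (hf : SmoothObjective f B G L ρ)
    (hA : ∀ i, SmoothAlgorithm (A i) G' L') (z : Fin k → E l) (i : Fin k) :
    Differentiable ℝ (sampleObj f A z i) := fun x =>
  (hf.differentiable _).comp x
    (hasFDerivAt_graph ((hA i).differentiable (z i) x).hasFDerivAt).differentiableAt

/-- Two distinct points force G, L, G', L' to be nonnegative, as the product estimates require. In
dimension zero these signs may fail, and the bounds are obtained separately below. -/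
lemma fderiv_sampleObj_bounds [Nontrivial (E d₁)] (hf : SmoothObjective f B G L ρ)
    (hA : ∀ i, SmoothAlgorithm (A i) G' L') (z : Fin k → E l) (i : Fin k) :
    (∀ x, ‖fderiv ℝ (sampleObj f A z i) x‖ ≤ G * (1 + G')) ∧
    ∀ x y, ‖fderiv ℝ (sampleObj f A z i) x - fderiv ℝ (sampleObj f A z i) y‖ ≤
      (L * (1 + G') ^ 2 + G * L') * ‖x - y‖ := by
  obtain ⟨x₁, x₂, hne⟩ := exists_pair_ne (E d₁)
  have hpos : 0 < ‖x₁ - x₂‖ := norm_pos_iff.2 (sub_ne_zero.2 hne)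
  have hG' : 0 ≤ G' :=
    nonneg_of_mul_nonneg_left ((norm_nonneg _).trans ((hA i).lipschitz (z i) x₁ x₂)) hpos
  have hL' : 0 ≤ L' :=
    nonneg_of_mul_nonneg_left ((norm_nonneg _).trans ((hA i).jacobian_lipschitz (z i) x₁ x₂)) hpos
  have hpos' : 0 < ‖(WithLp.toLp 2 (x₁, 0) : EProd d₁ d₂) - WithLp.toLp 2 (x₂, 0)‖ :=
    norm_pos_iff.2 (sub_ne_zero.2 fun he => hne (congrArg WithLp.fst he))
  have hG : 0 ≤ G := nonneg_of_mul_nonneg_left ((abs_nonneg _).trans (hf.lipschitz _ _)) hpos'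
  have hL : 0 ≤ L :=
    nonneg_of_mul_nonneg_left ((norm_nonneg _).trans (hf.gradient_lipschitz _ _)) hpos'
  have hDf : ∀ w, ‖fderiv ℝ f w‖ ≤ G := fun w =>
    norm_fderiv_le_of_lip' ℝ hG (Filter.Eventually.of_forall fun y => hf.lipschitz y w)
  have hh : Differentiable ℝ fun x => (WithLp.toLp 2 (x, A i x (z i)) : EProd d₁ d₂) := fun x =>
    (hasFDerivAt_graph ((hA i).differentiable (z i) x).hasFDerivAt).differentiableAt
  have hDh := norm_fderiv_graph_le hG' ((hA i).lipschitz (z i))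
  have hlip := norm_graph_sub_le ((hA i).lipschitz (z i))
  have hDlip := norm_fderiv_graph_sub_le hL' ((hA i).differentiable (z i))
    ((hA i).jacobian_lipschitz (z i))
  have hDflip : ∀ w₁ w₂, ‖fderiv ℝ f w₁ - fderiv ℝ f w₂‖ ≤ L * ‖w₁ - w₂‖ := fun w₁ w₂ => by
    rw [← norm_gradient_sub]; exact hf.gradient_lipschitz w₁ w₂
  have hH : 0 ≤ 1 + G' := by linarith
  exact ⟨fun x => norm_fderiv_comp_le hG hf.differentiable hh hDf hDh x,
    fun x y => norm_fderiv_comp_sub_le hG hL hH hf.differentiable hh hDf hDflip hlip hDh hDlip x y⟩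

lemma norm_fderiv_sampleObj_le (hf : SmoothObjective f B G L ρ)
    (hA : ∀ i, SmoothAlgorithm (A i) G' L') (hGhat : 0 < G * (1 + G'))
    (z : Fin k → E l) (i : Fin k) (x : E d₁) :
    ‖fderiv ℝ (sampleObj f A z i) x‖ ≤ G * (1 + G') := by
  rcases subsingleton_or_nontrivial (E d₁) with hs | hs
  · rw [Subsingleton.elim (fderiv ℝ (sampleObj f A z i) x) 0, norm_zero]; exact hGhat.le
  · exact (fderiv_sampleObj_bounds hf hA z i).1 x

lemma norm_fderiv_sampleObj_sub_le (hf : SmoothObjective f B G L ρ)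
    (hA : ∀ i, SmoothAlgorithm (A i) G' L') (z : Fin k → E l) (i : Fin k) (x y : E d₁) :
    ‖fderiv ℝ (sampleObj f A z i) x - fderiv ℝ (sampleObj f A z i) y‖ ≤
      (L * (1 + G') ^ 2 + G * L') * ‖x - y‖ := by
  rcases subsingleton_or_nontrivial (E d₁) with hs | hs
  · rw [Subsingleton.elim x y]; simp
  · exact (fderiv_sampleObj_bounds hf hA z i).2 x y

lemma sampleObj_lower_bound (hf : SmoothObjective f B G L ρ)
    (hA : ∀ i, SmoothAlgorithm (A i) G' L') (z : Fin k → E l) (i : Fin k) (x y : E d₁) :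
    sampleObj f A z i x + fderiv ℝ (sampleObj f A z i) x (y - x) -
      (L * (1 + G') ^ 2 + G * L') / 2 * ‖y - x‖ ^ 2 ≤ sampleObj f A z i y :=
  quadratic_lower_bound (differentiable_sampleObj hf hA z i)
    (norm_fderiv_sampleObj_sub_le hf hA z i) x y

lemma measurable_sampleObj (hf : SmoothObjective f B G L ρ)
    (hA_meas : ∀ i x, Measurable (A i x)) (i : Fin k) (x : E d₁) :
    Measurable fun z => sampleObj f A z i x := by
  exact (continuous_section hf.differentiable x).measurable.comp
    ((hA_meas i x).comp (measurable_pi_apply i))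

/-- `x ↦ max_i f(x, 𝒜_i(x, z_i))`. -/
def maxObj (f : EProd d₁ d₂ → ℝ) (A : Fin k → E d₁ → E l → E d₂) (z : Fin k → E l)
    (x : E d₁) : ℝ :=
  ⨆ i, sampleObj f A z i x

lemma sampleObj_le_maxObj (z : Fin k → E l) (i : Fin k) (x : E d₁) :
    sampleObj f A z i x ≤ maxObj f A z x :=
  le_ciSup (Set.finite_range fun i => sampleObj f A z i x).bddAbove i

lemma measurable_maxObj (hf : SmoothObjective f B G L ρ)
    (hA_meas : ∀ i x, Measurable (A i x)) (x : E d₁) : Measurable fun z => maxObj f A z x :=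
  Measurable.iSup fun i => measurable_sampleObj hf hA_meas i x

variable [NeZero k]

lemma abs_maxObj_le (hf : SmoothObjective f B G L ρ) (z : Fin k → E l) (x : E d₁) :
    |maxObj f A z x| ≤ B :=
  abs_le.2 ⟨(neg_le_of_abs_le (hf.bounded _)).trans (sampleObj_le_maxObj z 0 x),
    ciSup_le fun _ => le_of_abs_le (hf.bounded _)⟩

lemma strongConvexOn_maxObj (hf : SmoothObjective f B G L ρ)
    (hA : ∀ i, SmoothAlgorithm (A i) G' L') (z : Fin k → E l) :
    StrongConvexOn Set.univ (-(L * (1 + G') ^ 2 + G * L')) (maxObj f A z) :=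
  StrongConvexOn.iSup_fin fun i =>
    strongConvexOn_neg_of_lower_bound (sampleObj_lower_bound hf hA z i)

lemma continuous_maxObj (hf : SmoothObjective f B G L ρ)
    (hA : ∀ i, SmoothAlgorithm (A i) G' L') (z : Fin k → E l) :
    Continuous (maxObj f A z) := by
  have h : maxObj f A z = Finset.univ.sup' Finset.univ_nonempty fun i => sampleObj f A z i := by
    ext x
    rw [Finset.sup'_apply, Finset.sup'_univ_eq_ciSup]
    rfl
  rw [h]
  exact Continuous.finset_sup' _ fun i _ => (differentiable_sampleObj hf hA z i).continuous

lemma measurable_uncurry_maxObj (hf : SmoothObjective f B G L ρ)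
    (hA : ∀ i, SmoothAlgorithm (A i) G' L') (hA_meas : ∀ i x, Measurable (A i x)) :
    Measurable fun p : E d₁ × (Fin k → E l) => maxObj f A p.2 p.1 :=
  measurable_uncurry_of_continuous_of_measurable (u := fun x z => maxObj f A z x)
    (continuous_maxObj hf hA) (measurable_maxObj hf hA_meas)

variable {ν : Fin k → Measure (E l)} [∀ i, IsProbabilityMeasure (ν i)]

lemma integrable_maxObj (hf : SmoothObjective f B G L ρ)
    (hA_meas : ∀ i x, Measurable (A i x)) (x : E d₁) :
    Integrable (fun z => maxObj f A z x) (Measure.pi ν) :=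
  Integrable.of_bound (measurable_maxObj hf hA_meas x).aestronglyMeasurable B
    (Filter.Eventually.of_forall fun z => abs_maxObj_le hf z x)

lemma abs_robustObj_le (hf : SmoothObjective f B G L ρ) (x : E d₁) : |robustObj f A ν x| ≤ B := by
  refine (norm_integral_le_of_norm_le_const (μ := Measure.pi ν) (C := B)
    (f := fun z => maxObj f A z x) (Filter.Eventually.of_forall fun z => abs_maxObj_le hf z x)).trans ?_
  simp

lemma strongConvexOn_robustObj (hf : SmoothObjective f B G L ρ)
    (hA : ∀ i, SmoothAlgorithm (A i) G' L') (hA_meas : ∀ i x, Measurable (A i x)) :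
    StrongConvexOn Set.univ (-(L * (1 + G') ^ 2 + G * L')) (robustObj f A ν) :=
  StrongConvexOn.integral (F := maxObj f A) (strongConvexOn_maxObj hf hA)
    (integrable_maxObj hf hA_meas)

lemma continuous_robustObj (hf : SmoothObjective f B G L ρ)
    (hA : ∀ i, SmoothAlgorithm (A i) G' L') (hA_meas : ∀ i x, Measurable (A i x)) :
    Continuous (robustObj f A ν) :=
  continuous_of_dominated (F := fun x z => maxObj f A z x) (bound := fun _ => B)
    (fun x => (measurable_maxObj hf hA_meas x).aestronglyMeasurable)
    (fun x => Filter.Eventually.of_forall fun z => abs_maxObj_le hf z x) (integrable_const B)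
    (Filter.Eventually.of_forall fun z => continuous_maxObj hf hA z)

end Sample

/-! ### Proximal points and the Moreau envelope of a weakly convex function. -/

section Moreau

variable {d : ℕ} {g : E d → ℝ} {B K : ℝ}

lemma exists_prox (hg : Continuous g) (hB : ∀ x, -B ≤ g x) (hK : 0 < K) (x : E d) :
    ∃ p, ∀ u, g p + K * ‖x - p‖ ^ 2 ≤ g u + K * ‖x - u‖ ^ 2 := by
  refine Continuous.exists_forall_le (f := fun u => g u + K * ‖x - u‖ ^ 2) (by fun_prop) ?_
  have h1 : Filter.Tendsto (fun u : E d => ‖x - u‖) (Filter.cocompact _) Filter.atTop := by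
    refine Filter.tendsto_atTop_mono (fun u => ?_)
      (Filter.tendsto_atTop_add_const_left _ (-‖x‖) (tendsto_norm_cocompact_atTop (E := E d)))
    have := norm_sub_norm_le u x
    rw [norm_sub_rev] at this
    linarith
  have h2 := (Filter.tendsto_pow_atTop two_ne_zero).comp h1
  exact Filter.tendsto_atTop_mono (fun u => by simpa using hB u)
    (Filter.tendsto_atTop_add_const_left _ (-B) (h2.const_mul_atTop hK))

lemma isLeast_moreauEnvelope (hK : 0 < K) {x p : E d}
    (hp : ∀ u, g p + K * ‖x - p‖ ^ 2 ≤ g u + K * ‖x - u‖ ^ 2) :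
    IsLeast (Set.range fun u => g u + K * ‖x - u‖ ^ 2) (moreauEnvelope g (1 / (2 * K)) x) ∧
      moreauEnvelope g (1 / (2 * K)) x = g p + K * ‖x - p‖ ^ 2 := by
  have e : (2 * (1 / (2 * K)))⁻¹ = K := by field_simp
  have hl : IsLeast (Set.range fun u => g u + K * ‖x - u‖ ^ 2) (g p + K * ‖x - p‖ ^ 2) :=
    ⟨⟨p, rfl⟩, by rintro _ ⟨u, rfl⟩; exact hp u⟩
  have h : moreauEnvelope g (1 / (2 * K)) x = g p + K * ‖x - p‖ ^ 2 := by
    rw [moreauEnvelope, e]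
    exact hl.csInf_eq
  exact ⟨h ▸ hl, h⟩

/-- Quadratic growth of the proximal objective away from its minimizer. -/
lemma prox_quadratic_growth (hg : StrongConvexOn Set.univ (-K) g) {x p : E d}
    (hp : ∀ u, g p + K * ‖x - p‖ ^ 2 ≤ g u + K * ‖x - u‖ ^ 2) (u : E d) :
    g p + K * ‖x - p‖ ^ 2 + K / 2 * ‖u - p‖ ^ 2 ≤ g u + K * ‖x - u‖ ^ 2 := by
  -- Minimality of p is tested on the segment towards u and divided by t. The quadratic contributes
  -- convexity 2K and g costs at most K, which leaves K as t tends to 0.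
  have key : ∀ t ∈ Set.Ioo (0 : ℝ) 1, g p + K * ‖x - p‖ ^ 2 + K / 2 * (1 - t) * ‖u - p‖ ^ 2 ≤
      g u + K * ‖x - u‖ ^ 2 := by
    rintro t ⟨ht0, ht1⟩
    have h1 := hg.2 (Set.mem_univ p) (Set.mem_univ u) (sub_nonneg.2 ht1.le) ht0.le (by ring)
    have h2 := hp ((1 - t) • p + t • u)
    have e1 : x - ((1 - t) • p + t • u) = (x - p) - t • (u - p) := by module
    have e2 : x - u = (x - p) - (u - p) := by abel
    rw [e1, norm_sub_sq_real (x - p) (t • (u - p)), inner_smul_right, norm_smul,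
      Real.norm_eq_abs, mul_pow, sq_abs] at h2
    rw [e2, norm_sub_sq_real (x - p)]
    rw [norm_sub_rev p u] at h1
    simp only [smul_eq_mul] at h1
    refine le_of_mul_le_mul_left ?_ ht0
    nlinarith
  have hlim : Filter.Tendsto
      (fun t : ℝ => g p + K * ‖x - p‖ ^ 2 + K / 2 * (1 - t) * ‖u - p‖ ^ 2)
      (nhdsWithin 0 (Set.Ioi 0))
      (nhds (g p + K * ‖x - p‖ ^ 2 + K / 2 * (1 - 0) * ‖u - p‖ ^ 2)) :=
    (Continuous.tendsto (by fun_prop) 0).mono_left nhdsWithin_le_nhds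
  rw [sub_zero, mul_one] at hlim
  refine le_of_tendsto hlim ?_
  filter_upwards [Ioo_mem_nhdsGT (zero_lt_one' ℝ)] with t ht using key t ht

/-- Adding the growth inequalities of p at q and of q at p cancels the values of g and leaves ‖p -
q‖² ≤ 2⟨x - y, p - q⟩; Cauchy–Schwarz finishes. -/
lemma prox_lipschitz (hK : 0 < K) (hg : StrongConvexOn Set.univ (-K) g) {x y p q : E d}
    (hp : ∀ u, g p + K * ‖x - p‖ ^ 2 ≤ g u + K * ‖x - u‖ ^ 2)
    (hq : ∀ u, g q + K * ‖y - q‖ ^ 2 ≤ g u + K * ‖y - u‖ ^ 2) :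
    ‖p - q‖ ≤ 2 * ‖x - y‖ := by
  have h1 := prox_quadratic_growth hg hp q
  have h2 := prox_quadratic_growth hg hq p
  rw [norm_sub_rev q p] at h1
  have e : ‖x - q‖ ^ 2 - ‖x - p‖ ^ 2 + ‖y - p‖ ^ 2 - ‖y - q‖ ^ 2 = 2 * inner ℝ (x - y) (p - q) := by
    simp only [norm_sub_sq_real, inner_sub_left, inner_sub_right]; ring
  have h3 : ‖p - q‖ ^ 2 ≤ 2 * inner ℝ (x - y) (p - q) := by
    refine le_of_mul_le_mul_left ?_ hK
    nlinarith
  have h4 := real_inner_le_norm (x - y) (p - q)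
  rcases (norm_nonneg (p - q)).eq_or_lt with h0 | h0
  · rw [← h0]; positivity
  · nlinarith

lemma moreauEnvelope_le (hK : 0 < K) (hB : ∀ x, -B ≤ g x) (x u : E d) :
    moreauEnvelope g (1 / (2 * K)) x ≤ g u + K * ‖x - u‖ ^ 2 := by
  have e : (2 * (1 / (2 * K)))⁻¹ = K := by field_simp
  rw [moreauEnvelope, e]
  exact ciInf_le ⟨-B, by rintro _ ⟨u, rfl⟩; have := hB u; simp only; nlinarith [sq_nonneg ‖x - u‖]⟩ u

/-- Each envelope value is tested with the proximal point of the other base point. This squeezes the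
first-order remainder between -3K‖y - x‖² and K‖y - x‖², the lower side using `prox_lipschitz`; the
constant 5K below is not sharp. -/
lemma hasGradientAt_moreauEnvelope (hg : Continuous g) (hB : ∀ x, -B ≤ g x) (hK : 0 < K)
    (hgc : StrongConvexOn Set.univ (-K) g) {x p : E d}
    (hp : ∀ u, g p + K * ‖x - p‖ ^ 2 ≤ g u + K * ‖x - u‖ ^ 2) :
    HasGradientAt (moreauEnvelope g (1 / (2 * K))) ((2 * K) • (x - p)) x := by
  rw [hasGradientAt_iff_isLittleO]
  refine Asymptotics.IsBigO.trans_isLittleO (g := fun y => ‖y - x‖ ^ 2) ?_ ?_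
  · refine Asymptotics.IsBigO.of_bound (5 * K) (Filter.Eventually.of_forall fun y => ?_)
    obtain ⟨q, hq⟩ := exists_prox hg hB hK y
    have ex := (isLeast_moreauEnvelope hK hp).2
    have ey := (isLeast_moreauEnvelope hK hq).2
    have h1 := moreauEnvelope_le hK hB y p
    have h2 := moreauEnvelope_le hK hB x q
    have hpq := prox_lipschitz hK hgc hp hq
    have e1 : y - p = (x - p) + (y - x) := by abel
    have e2 : x - q = (y - q) - (y - x) := by abel
    have e3 : y - q = (x - p) + (y - x) + (p - q) := by abel
    have e4 : inner ℝ (y - q) (y - x) =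
        inner ℝ (x - p) (y - x) + ‖y - x‖ ^ 2 + inner ℝ (p - q) (y - x) := by
      rw [e3, inner_add_left, inner_add_left, real_inner_self_eq_norm_sq]
    have e5 : ‖y - p‖ ^ 2 = ‖x - p‖ ^ 2 + 2 * inner ℝ (x - p) (y - x) + ‖y - x‖ ^ 2 := by
      rw [e1, norm_add_sq_real]
    have e6 : ‖x - q‖ ^ 2 = ‖y - q‖ ^ 2 - 2 * inner ℝ (y - q) (y - x) + ‖y - x‖ ^ 2 := by
      rw [e2, norm_sub_sq_real]
    have h3 : |inner ℝ (p - q) (y - x)| ≤ 2 * ‖y - x‖ ^ 2 := by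
      refine (abs_real_inner_le_norm _ _).trans ?_
      rw [norm_sub_rev x y] at hpq
      nlinarith [norm_nonneg (y - x)]
    have h4 := abs_le.1 h3
    rw [real_inner_smul_left, Real.norm_eq_abs, norm_pow, norm_norm, abs_le]
    rw [e5] at h1
    rw [e6, e4] at h2
    constructor <;> nlinarith [mul_le_mul_of_nonneg_left h4.1 hK.le,
      mul_le_mul_of_nonneg_left h4.2 hK.le,
      mul_nonneg hK.le (sq_nonneg ‖y - x‖)]
  · have h := (Asymptotics.isBigO_refl (fun y => ‖y - x‖) (nhds x)).mul_isLittleO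
      ((Asymptotics.isLittleO_one_iff ℝ).2
        (show Filter.Tendsto (fun y : E d => ‖y - x‖) (nhds x) (nhds 0) by
          simpa using (Continuous.tendsto (f := fun y : E d => ‖y - x‖) (by fun_prop) x)))
    simp only [mul_one, ← pow_two] at h
    exact h.of_norm_right

/-- A proximal point `p` of `x` and the gradient of the Moreau envelope at `x`. -/
lemma norm_gradient_moreauEnvelope (hg : Continuous g) (hB : ∀ x, -B ≤ g x) (hK : 0 < K)
    (hgc : StrongConvexOn Set.univ (-K) g) {x p : E d}
    (hp : ∀ u, g p + K * ‖x - p‖ ^ 2 ≤ g u + K * ‖x - u‖ ^ 2) :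
    ‖gradient (moreauEnvelope g (1 / (2 * K))) x‖ = 2 * K * ‖x - p‖ := by
  rw [(hasGradientAt_moreauEnvelope hg hB hK hgc hp).gradient, norm_smul, Real.norm_eq_abs,
    abs_of_pos (by positivity)]

lemma abs_moreauEnvelope_le (hB : ∀ x, |g x| ≤ B) (hK : 0 < K) (x : E d) :
    |moreauEnvelope g (1 / (2 * K)) x| ≤ B := by
  have hB' : ∀ x, -B ≤ g x := fun x => (abs_le.1 (hB x)).1
  refine abs_le.2 ⟨?_, ?_⟩
  · refine le_ciInf fun u => ?_
    have : 0 ≤ (2 * (1 / (2 * K)))⁻¹ * ‖x - u‖ ^ 2 := by positivity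
    linarith [hB' u]
  · have := moreauEnvelope_le hK hB' x x
    simp only [sub_self, norm_zero] at this
    linarith [(abs_le.1 (hB x)).2]

/-- Taking x itself as competitor gives K‖x - p‖² ≤ 2B. The bound supplies integrability along the
run and settles the case B = 0. -/
lemma sq_norm_gradient_moreauEnvelope_le (hg : Continuous g) (hB : ∀ x, |g x| ≤ B) (hK : 0 < K)
    (hgc : StrongConvexOn Set.univ (-K) g) (x : E d) :
    ‖gradient (moreauEnvelope g (1 / (2 * K))) x‖ ^ 2 ≤ 8 * K * B := by
  have hB' : ∀ x, -B ≤ g x := fun x => (abs_le.1 (hB x)).1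
  obtain ⟨p, hp⟩ := exists_prox hg hB' hK x
  rw [norm_gradient_moreauEnvelope hg hB' hK hgc hp]
  have h := hp x
  simp only [sub_self, norm_zero] at h
  have h1 : K * ‖x - p‖ ^ 2 ≤ 2 * B := by linarith [(abs_le.1 (hB x)).2, hB' p]
  nlinarith

/-- At a proximal point of `x` the function value drops by a multiple of the squared norm of the
gradient of the Moreau envelope. -/
lemma prox_decrease (hg : Continuous g) (hB : ∀ x, -B ≤ g x) (hK : 0 < K)
    (hgc : StrongConvexOn Set.univ (-K) g) {x p : E d}
    (hp : ∀ u, g p + K * ‖x - p‖ ^ 2 ≤ g u + K * ‖x - u‖ ^ 2) :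
    g p - g x + K / 2 * ‖p - x‖ ^ 2 ≤
      -(‖gradient (moreauEnvelope g (1 / (2 * K))) x‖ ^ 2 / (4 * K)) := by
  have h := prox_quadratic_growth hgc hp x
  rw [norm_gradient_moreauEnvelope hg hB hK hgc hp, norm_sub_rev p x]
  have e : (2 * K * ‖x - p‖) ^ 2 / (4 * K) = K * ‖x - p‖ ^ 2 := by field_simp; ring
  rw [e]
  simp only [sub_self, norm_zero] at h
  linarith

/-- Effect on the Moreau envelope of a step along a vector. -/
lemma moreauEnvelope_step_le (hB : ∀ x, -B ≤ g x) (hK : 0 < K) {x p : E d}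
    (hp : ∀ u, g p + K * ‖x - p‖ ^ 2 ≤ g u + K * ‖x - u‖ ^ 2) (η : ℝ) (v : E d) :
    moreauEnvelope g (1 / (2 * K)) (x - η • v) ≤ moreauEnvelope g (1 / (2 * K)) x +
      2 * K * η * inner ℝ v (p - x) + K * η ^ 2 * ‖v‖ ^ 2 := by
  have h := moreauEnvelope_le hK hB (x - η • v) p
  rw [(isLeast_moreauEnvelope hK hp).2]
  have e1 : x - η • v - p = (x - p) - η • v := by abel
  have e2 : inner ℝ v (p - x) = -inner ℝ (x - p) v := by
    rw [← neg_sub x p, inner_neg_right, real_inner_comm]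
  rw [e1, norm_sub_sq_real (x - p) (η • v), inner_smul_right, norm_smul, Real.norm_eq_abs, mul_pow,
    sq_abs] at h
  rw [e2]
  linarith

lemma measurable_gradient (h : E d → ℝ) : Measurable (gradient h) :=
  (InnerProductSpace.toDual ℝ (E d)).symm.continuous.measurable.comp (measurable_fderiv ℝ h)

end Moreau

/-! ### The stochastic subgradient: weak subgradient inequality, norm bound, measurability. -/

section Subgradient

variable {d₁ d₂ l k : ℕ} {f : EProd d₁ d₂ → ℝ} {A : Fin k → E d₁ → E l → E d₂}
  {B G L ρ G' L' : ℝ}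

lemma maxObj_eq_sum_of_isArgmaxWeight [NeZero k] {z : Fin k → E l} {x : E d₁} {c : Fin k → ℝ}
    (hc : IsArgmaxWeight f A z x c) : ∑ i, c i * sampleObj f A z i x = maxObj f A z x := by
  have h : ∀ i, c i * sampleObj f A z i x = c i * maxObj f A z x := fun i => by
    by_cases hi : c i = 0
    · simp [hi]
    · rw [le_antisymm (sampleObj_le_maxObj z i x) (ciSup_le (hc.2 i hi))]
  rw [Finset.sum_congr rfl fun i _ => h i, ← Finset.sum_mul, hc.1.2, one_mul]

/-- The lower models of the active samples are averaged with the weights: at x the active values all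
equal the maximum, and at y each value is at most the maximum. -/
lemma stochSubgradient_inner_le [NeZero k] (hf : SmoothObjective f B G L ρ)
    (hA : ∀ i, SmoothAlgorithm (A i) G' L') {z : Fin k → E l} {x : E d₁} {c : Fin k → ℝ}
    (hc : IsArgmaxWeight f A z x c) (y : E d₁) :
    inner ℝ (stochSubgradient f A z x c) (y - x) ≤
      maxObj f A z y - maxObj f A z x + (L * (1 + G') ^ 2 + G * L') / 2 * ‖y - x‖ ^ 2 := by
  have h : ∀ i, c i * inner ℝ (gradient (sampleObj f A z i) x) (y - x) ≤
      c i * (maxObj f A z y + (L * (1 + G') ^ 2 + G * L') / 2 * ‖y - x‖ ^ 2) -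
        c i * sampleObj f A z i x := fun i => by
    rw [← mul_sub]
    refine mul_le_mul_of_nonneg_left ?_ (hc.1.1 i)
    rw [inner_gradient_left]
    linarith [sampleObj_lower_bound hf hA z i x y, sampleObj_le_maxObj (f := f) (A := A) z i y]
  have hs := Finset.sum_le_sum fun i (_ : i ∈ Finset.univ) => h i
  rw [Finset.sum_sub_distrib, ← Finset.sum_mul, hc.1.2, one_mul,
    maxObj_eq_sum_of_isArgmaxWeight hc] at hs
  simp only [stochSubgradient, sum_inner, real_inner_smul_left]
  linarith

lemma norm_stochSubgradient_le (hf : SmoothObjective f B G L ρ)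
    (hA : ∀ i, SmoothAlgorithm (A i) G' L') (hGhat : 0 < G * (1 + G'))
    {z : Fin k → E l} {x : E d₁} {c : Fin k → ℝ}
    (hc : IsArgmaxWeight f A z x c) : ‖stochSubgradient f A z x c‖ ≤ G * (1 + G') := by
  calc ‖stochSubgradient f A z x c‖ ≤ ∑ i, c i * (G * (1 + G')) := norm_sum_le_of_le _ fun i _ => by
        rw [norm_smul, Real.norm_of_nonneg (hc.1.1 i), norm_gradient]
        exact mul_le_mul_of_nonneg_left (norm_fderiv_sampleObj_le hf hA hGhat z i x) (hc.1.1 i)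
    _ = G * (1 + G') := by rw [← Finset.sum_mul, hc.1.2, one_mul]

lemma measurable_uncurry_sampleObj (hf : SmoothObjective f B G L ρ)
    (hA : ∀ i, SmoothAlgorithm (A i) G' L') (hA_meas : ∀ i x, Measurable (A i x)) (i : Fin k) :
    Measurable fun p : E d₁ × (Fin k → E l) => sampleObj f A p.2 i p.1 :=
  measurable_uncurry_of_continuous_of_measurable (u := fun x z => sampleObj f A z i x)
    (fun z => (differentiable_sampleObj hf hA z i).continuous) (measurable_sampleObj hf hA_meas i)

lemma measurable_uncurry_gradient_sampleObj (hf : SmoothObjective f B G L ρ)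
    (hA : ∀ i, SmoothAlgorithm (A i) G' L') (hA_meas : ∀ i x, Measurable (A i x)) (i : Fin k) :
    Measurable fun p : E d₁ × (Fin k → E l) => gradient (sampleObj f A p.2 i) p.1 := by
  have hdir : ∀ v : E d₁, Measurable fun p : E d₁ × (Fin k → E l) =>
      fderiv ℝ (sampleObj f A p.2 i) p.1 v := fun v => by
    -- Joint measurability in point and seed: directional derivatives are limits of the jointly
    -- measurable quotients n(F(x + v/n) - F(x)), and the gradient is rebuilt from its coordinates.
    have hlim := fun p : E d₁ × (Fin k → E l) =>
      ((differentiable_sampleObj hf hA p.2 i p.1).hasFDerivAt.lim_real v).comp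
        tendsto_natCast_atTop_atTop
    refine measurable_of_tendsto_metrizable (fun n => ?_) (tendsto_pi_nhds.2 hlim)
    have hu := measurable_uncurry_sampleObj hf hA hA_meas i
    have hs : Measurable fun p : E d₁ × (Fin k → E l) => (p.1 + (n : ℝ)⁻¹ • v, p.2) :=
      (measurable_fst.add_const _).prodMk measurable_snd
    exact ((hu.comp hs).sub hu).const_smul (n : ℝ)
  have h : (fun p : E d₁ × (Fin k → E l) => gradient (sampleObj f A p.2 i) p.1) = fun p =>
      ∑ j, fderiv ℝ (sampleObj f A p.2 i) p.1 (EuclideanSpace.basisFun (Fin d₁) ℝ j) •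
        EuclideanSpace.basisFun (Fin d₁) ℝ j := by
    ext1 p
    conv_lhs => rw [← (EuclideanSpace.basisFun (Fin d₁) ℝ).sum_repr' (gradient _ _)]
    refine Finset.sum_congr rfl fun j _ => ?_
    rw [real_inner_comm, inner_gradient_left]
  rw [h]
  exact Finset.measurable_sum _ fun j _ => (hdir _).smul_const _

end Subgradient

/-! ### Measurability of the iterates and their independence from the fresh seeds. -/

section Run

variable {d₁ d₂ l k : ℕ} {f : EProd d₁ d₂ → ℝ} {A : Fin k → E d₁ → E l → E d₂}
  {B G L ρ G' L' : ℝ} {ν : Fin k → Measure (E l)} {S : ℕ} {η : ℝ} {x₀ : E d₁}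
  {Ω : Type*} {mΩ : MeasurableSpace Ω} {P : Measure Ω}
  {z : ℕ → Ω → Fin k → E l} {c : ℕ → Ω → Fin k → ℝ} {x : ℕ → Ω → E d₁} {τ : Ω → ℕ}

/-- The iterates are measurable with respect to any σ-algebra that makes the past seeds and weights
measurable. -/
lemma measurable_iterate_of_past {Ω : Type*} {m : MeasurableSpace Ω}
    {z : ℕ → Ω → Fin k → E l} {c : ℕ → Ω → Fin k → ℝ} {x : ℕ → Ω → E d₁}
    (hf : SmoothObjective f B G L ρ)
    (hA : ∀ i, SmoothAlgorithm (A i) G' L') (hA_meas : ∀ i x, Measurable (A i x))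
    (hinit : ∀ ω, x 0 ω = x₀) (hstep : ∀ s ≤ S, ∀ ω,
      x (s + 1) ω = x s ω - η • stochSubgradient f A (z s ω) (x s ω) (c s ω)) :
    ∀ t ≤ S + 1, (∀ r < t, Measurable (z r)) → (∀ r < t, Measurable (c r)) → Measurable (x t)
  | 0, _, _, _ => by
    rw [show x 0 = fun _ => x₀ from funext hinit]
    exact measurable_const
  | t + 1, ht, hz, hc => by
    have hx := measurable_iterate_of_past hf hA hA_meas hinit hstep t (by omega)
      (fun r hr => hz r (by omega)) (fun r hr => hc r (by omega))
    rw [show x (t + 1) = _ from funext (hstep t (by omega))]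
    refine hx.sub (Measurable.const_smul ?_ η)
    refine Finset.measurable_sum _ fun i _ => ?_
    have h1 : Measurable fun ω => c t ω i := (measurable_pi_apply i).comp (hc t t.lt_succ_self)
    have h2 : Measurable fun ω => gradient (sampleObj f A (z t ω) i) (x t ω) :=
      (measurable_uncurry_gradient_sampleObj hf hA hA_meas i).comp
        (hx.prodMk (hz t t.lt_succ_self))
    exact h1.smul h2

lemma IsSGDRun.measurable_iterate (hrun : IsSGDRun P f A ν S x₀ η z c x τ)
    (hf : SmoothObjective f B G L ρ)
    (hA : ∀ i, SmoothAlgorithm (A i) G' L') (hA_meas : ∀ i x, Measurable (A i x))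
    {t : ℕ} (ht : t ≤ S + 1) : Measurable (x t) :=
  measurable_iterate_of_past hf hA hA_meas hrun.init hrun.step t ht
    (fun r _ => hrun.measurable_seed r) fun r _ => hrun.measurable_weight r

/-- The iterate is measurable for the σ-algebra generated by the earlier seeds and weights alone,
and the present seeds are independent of that. -/
lemma IsSGDRun.indepFun_iterate_seed (hrun : IsSGDRun P f A ν S x₀ η z c x τ)
    (hf : SmoothObjective f B G L ρ)
    (hA : ∀ i, SmoothAlgorithm (A i) G' L') (hA_meas : ∀ i x, Measurable (A i x))
    {s : ℕ} (hs : s ≤ S) : IndepFun (x s) (z s) P := by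
  have h := (IndepFun_iff_Indep _ _ _).1 (hrun.fresh_seed s hs)
  refine ((IndepFun_iff_Indep _ _ _).2 (indep_of_indep_of_le_right h ?_)).symm
  have hcoord := fun r : Fin s =>
    (measurable_pi_apply r).comp (comap_measurable fun ω (r : Fin s) => (z r ω, c r ω))
  refine Measurable.comap_le (measurable_iterate_of_past hf hA hA_meas hrun.init hrun.step
    s (by omega) ?_ ?_)
  · exact fun r hr => measurable_fst.comp (hcoord ⟨r, hr⟩)
  · exact fun r hr => measurable_snd.comp (hcoord ⟨r, hr⟩)

variable [IsProbabilityMeasure P] [NeZero k] [∀ i, IsProbabilityMeasure (ν i)]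

/-- Freshness of the seeds: the sampled objective has the right conditional mean. -/
lemma IsSGDRun.integral_maxObj (hrun : IsSGDRun P f A ν S x₀ η z c x τ)
    (hf : SmoothObjective f B G L ρ)
    (hA : ∀ i, SmoothAlgorithm (A i) G' L') (hA_meas : ∀ i x, Measurable (A i x))
    {s : ℕ} (hs : s ≤ S) {q : E d₁ → E d₁} (hq : Measurable q) :
    ∫ ω, maxObj f A (z s ω) (q (x s ω)) ∂P = ∫ ω, robustObj f A ν (q (x s ω)) ∂P := by
  have hx := hrun.measurable_iterate hf hA hA_meas (t := s) (by omega)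
  have hz := hrun.measurable_seed s
  have hmap := (indepFun_iff_map_prod_eq_prod_map_map hx.aemeasurable hz.aemeasurable).1
    (hrun.indepFun_iterate_seed hf hA hA_meas hs)
  rw [hrun.law_seed s hs] at hmap
  have : IsProbabilityMeasure (P.map (x s)) := Measure.isProbabilityMeasure_map hx.aemeasurable
  have hM : Measurable fun p : E d₁ × (Fin k → E l) => maxObj f A p.2 (q p.1) :=
    (measurable_uncurry_maxObj hf hA hA_meas).comp
      ((hq.comp measurable_fst).prodMk measurable_snd)
  have hr : Measurable fun y => robustObj f A ν (q y) :=
    (continuous_robustObj hf hA hA_meas).measurable.comp hq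
  calc ∫ ω, maxObj f A (z s ω) (q (x s ω)) ∂P
      = ∫ p, maxObj f A p.2 (q p.1) ∂(P.map fun ω => (x s ω, z s ω)) :=
        (integral_map (hx.prodMk hz).aemeasurable hM.aestronglyMeasurable).symm
    _ = ∫ y, robustObj f A ν (q y) ∂(P.map (x s)) := by
        rw [hmap, integral_prod _ (Integrable.of_bound hM.aestronglyMeasurable B
          (Filter.Eventually.of_forall fun p => abs_maxObj_le hf _ _))]
        rfl
    _ = _ := integral_map hx.aemeasurable hr.aestronglyMeasurable

end Run

/-! ### Expected descent of the envelope, telescoping, and the random output. -/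

section Convergence

variable {d₁ d₂ l k : ℕ} {f : EProd d₁ d₂ → ℝ} {A : Fin k → E d₁ → E l → E d₂}
  {B G L ρ G' L' K : ℝ} {ν : Fin k → Measure (E l)} {S : ℕ} {η : ℝ} {x₀ : E d₁}
  {Ω : Type*} {mΩ : MeasurableSpace Ω} {P : Measure Ω} [IsProbabilityMeasure P] [NeZero k]
  [∀ i, IsProbabilityMeasure (ν i)]
  {z : ℕ → Ω → Fin k → E l} {c : ℕ → Ω → Fin k → ℝ} {x : ℕ → Ω → E d₁} {τ : Ω → ℕ}

/-- Expected decrease of the Moreau envelope in one step. -/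
lemma IsSGDRun.integral_moreauEnvelope_succ_le (hrun : IsSGDRun P f A ν S x₀ η z c x τ)
    (hf : SmoothObjective f B G L ρ)
    (hA : ∀ i, SmoothAlgorithm (A i) G' L') (hA_meas : ∀ i x, Measurable (A i x))
    (hK : K = L * (1 + G') ^ 2 + G * L') (hK0 : 0 < K) (hGhat : 0 < G * (1 + G')) (hη : 0 ≤ η)
    {s : ℕ} (hs : s ≤ S) :
    ∫ ω, moreauEnvelope (robustObj f A ν) (1 / (2 * K)) (x (s + 1) ω) ∂P ≤
      ∫ ω, moreauEnvelope (robustObj f A ν) (1 / (2 * K)) (x s ω) ∂P -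
        η / 2 * ∫ ω, ‖gradient (moreauEnvelope (robustObj f A ν) (1 / (2 * K))) (x s ω)‖ ^ 2 ∂P +
        K * η ^ 2 * (G * (1 + G')) ^ 2 := by
  set g := robustObj f A ν
  set φ := moreauEnvelope g (1 / (2 * K))
  have hg : Continuous g := continuous_robustObj hf hA hA_meas
  have hB : ∀ x, |g x| ≤ B := abs_robustObj_le hf
  have hB' : ∀ x, -B ≤ g x := fun x => (abs_le.1 (hB x)).1
  have hgc : StrongConvexOn Set.univ (-K) g := hK ▸ strongConvexOn_robustObj hf hA hA_meas
  choose p hp using exists_prox hg hB' hK0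
  have hgrad := fun y => (hasGradientAt_moreauEnvelope hg hB' hK0 hgc (hp y))
  have hp_meas : Measurable p := by
    -- The proximal map was picked by choice; the gradient formula determines it and so makes it
    -- measurable.
    have : p = fun y => y - (2 * K)⁻¹ • gradient φ y := by
      ext1 y
      rw [(hgrad y).gradient, inv_smul_smul₀ (by positivity), sub_sub_cancel]
    rw [this]
    exact measurable_id.sub ((measurable_gradient φ).fun_const_smul _)
  have hφ : Measurable φ :=
    (continuous_iff_continuousAt.2 fun y => (hgrad y).continuousAt).measurable
  have hx := hrun.measurable_iterate hf hA hA_meas (t := s) (by omega)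
  have hx' := hrun.measurable_iterate hf hA hA_meas (t := s + 1) (by omega)
  have hz := hrun.measurable_seed s
  have hM := fun {q : E d₁ → E d₁} (hq : Measurable q) => (Integrable.of_bound (μ := P)
    ((measurable_uncurry_maxObj hf hA hA_meas).comp
      ((hq.comp hx).prodMk hz)).aestronglyMeasurable B
    (Filter.Eventually.of_forall fun ω => abs_maxObj_le hf _ _) :
      Integrable (fun ω => maxObj f A (z s ω) (q (x s ω))) P)
  have hG := fun {q : E d₁ → E d₁} (hq : Measurable q) => (Integrable.of_bound (μ := P)
    (hg.measurable.comp (hq.comp hx)).aestronglyMeasurable B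
    (Filter.Eventually.of_forall fun ω => hB _) : Integrable (fun ω => g (q (x s ω))) P)
  have hφi := fun {y : Ω → E d₁} (hy : Measurable y) => (Integrable.of_bound (μ := P)
    (hφ.comp hy).aestronglyMeasurable B
    (Filter.Eventually.of_forall fun ω => abs_moreauEnvelope_le hB hK0 _) :
      Integrable (fun ω => φ (y ω)) P)
  have hN : Integrable (fun ω => ‖gradient φ (x s ω)‖ ^ 2) P := Integrable.of_bound
    (((measurable_gradient φ).comp hx).norm.pow_const 2).aestronglyMeasurable (8 * K * B)
    (Filter.Eventually.of_forall fun ω => by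
      rw [Real.norm_of_nonneg (sq_nonneg _)]
      exact sq_norm_gradient_moreauEnvelope_le hg hB hK0 hgc _)
  have hMp := hM hp_meas
  have hMx := hM measurable_id
  have hGp := hG hp_meas
  have hGx := hG measurable_id
  have e1 := hrun.integral_maxObj hf hA hA_meas hs hp_meas
  have e2 := hrun.integral_maxObj hf hA hA_meas hs measurable_id
  simp only [id_eq] at hMx hGx e2
  -- The weights may depend on the present seeds, so no conditional mean of the subgradient is
  -- taken. The weak subgradient inequality is applied for each outcome, which removes the weights;
  -- what remains is the sampled difference minus its mean, with expectation zero by `hI0`.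
  have hpt : ∀ ω, φ (x (s + 1) ω) ≤ φ (x s ω) +
      2 * K * η * ((maxObj f A (z s ω) (p (x s ω)) - maxObj f A (z s ω) (x s ω)) -
        (g (p (x s ω)) - g (x s ω))) - η / 2 * ‖gradient φ (x s ω)‖ ^ 2 +
        K * η ^ 2 * (G * (1 + G')) ^ 2 := fun ω => by
    rw [hrun.step s hs ω]
    have hw := hrun.weight s hs ω
    have h1 := moreauEnvelope_step_le hB' hK0 (hp (x s ω)) η
      (stochSubgradient f A (z s ω) (x s ω) (c s ω))
    have h2 := stochSubgradient_inner_le hf hA hw (p (x s ω))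
    have h3 := pow_le_pow_left₀ (norm_nonneg _) (norm_stochSubgradient_le hf hA hGhat hw) 2
    have h4 := prox_decrease hg hB' hK0 hgc (hp (x s ω))
    rw [← hK] at h2
    have hKη : 0 ≤ 2 * K * η := by positivity
    have h5 := mul_le_mul_of_nonneg_left h2 hKη
    have h6 := mul_le_mul_of_nonneg_left h4 hKη
    have h7 := mul_le_mul_of_nonneg_left h3 (show 0 ≤ K * η ^ 2 by positivity)
    have e : 2 * K * η * -(‖gradient φ (x s ω)‖ ^ 2 / (4 * K)) =
        -(η / 2 * ‖gradient φ (x s ω)‖ ^ 2) := by field_simp; ring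
    rw [e] at h6
    linarith
  have hI1 : Integrable (fun ω => (maxObj f A (z s ω) (p (x s ω)) - maxObj f A (z s ω) (x s ω)) -
        (g (p (x s ω)) - g (x s ω))) P := (hMp.sub hMx).sub (hGp.sub hGx)
  have hI0 : ∫ ω, ((maxObj f A (z s ω) (p (x s ω)) - maxObj f A (z s ω) (x s ω)) -
        (g (p (x s ω)) - g (x s ω))) ∂P = 0 := by
    have h1 := integral_sub (hMp.sub hMx) (hGp.sub hGx)
    rw [integral_sub' hMp hMx, integral_sub' hGp hGx, e1, e2] at h1
    refine h1.trans ?_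
    exact sub_self _
  have hI2 := (hφi hx).add (hI1.const_mul (2 * K * η))
  have hI3 := hI2.sub (hN.const_mul (η / 2))
  refine (integral_mono (hφi hx') (hI3.add (integrable_const _)) hpt).trans_eq ?_
  rw [integral_add' hI3 (integrable_const _), integral_sub' hI2 (hN.const_mul _),
    integral_add' (hφi hx) (hI1.const_mul _), integral_const_mul, hI0, integral_const_mul]
  simp

/-- Summed expected squared gradient norms of the Moreau envelope along a run. -/
lemma IsSGDRun.sum_integral_sq_norm_gradient_le (hrun : IsSGDRun P f A ν S x₀ η z c x τ)
    (hf : SmoothObjective f B G L ρ)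
    (hA : ∀ i, SmoothAlgorithm (A i) G' L') (hA_meas : ∀ i x, Measurable (A i x))
    (hK : K = L * (1 + G') ^ 2 + G * L') (hK0 : 0 < K) (hGhat : 0 < G * (1 + G')) (hη : 0 ≤ η) :
    η / 2 * ∑ s ∈ Finset.range (S + 1),
      ∫ ω, ‖gradient (moreauEnvelope (robustObj f A ν) (1 / (2 * K))) (x s ω)‖ ^ 2 ∂P ≤
      2 * B + (S + 1) * (K * η ^ 2 * (G * (1 + G')) ^ 2) := by
  set φ := moreauEnvelope (robustObj f A ν) (1 / (2 * K))
  have hφ : ∀ t, |∫ ω, φ (x t ω) ∂P| ≤ B := fun t => by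
    refine (norm_integral_le_of_norm_le_const (μ := P) (C := B) (f := fun ω => φ (x t ω))
      (Filter.Eventually.of_forall fun ω =>
        abs_moreauEnvelope_le (abs_robustObj_le hf) hK0 _)).trans ?_
    simp
  have h : ∀ s ∈ Finset.range (S + 1), η / 2 * ∫ ω, ‖gradient φ (x s ω)‖ ^ 2 ∂P ≤
      (∫ ω, φ (x s ω) ∂P - ∫ ω, φ (x (s + 1) ω) ∂P) + K * η ^ 2 * (G * (1 + G')) ^ 2 :=
    fun s hs => by
      have := hrun.integral_moreauEnvelope_succ_le hf hA hA_meas hK hK0 hGhat hη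
        (Finset.mem_range_succ_iff.1 hs)
      linarith
  have hs := Finset.sum_le_sum h
  rw [← Finset.mul_sum, Finset.sum_add_distrib, Finset.sum_range_sub', Finset.sum_const,
    Finset.card_range, nsmul_eq_mul] at hs
  push_cast at hs
  -- The telescoped sum ends at the iterate S + 1, one past the last possible output.
  linarith [(abs_le.1 (hφ 0)).2, (abs_le.1 (hφ (S + 1))).1]

omit [NeZero k] [∀ i, IsProbabilityMeasure (ν i)] in
/-- The output of a run averages over the iterates. -/
lemma IsSGDRun.integral_output (hrun : IsSGDRun P f A ν S x₀ η z c x τ)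
    (hx : ∀ s ≤ S, Measurable (x s)) {h : E d₁ → ℝ} (hh : Measurable h) {C : ℝ}
    (hC : ∀ y, |h y| ≤ C) :
    Integrable (fun ω => h (x (τ ω) ω)) P ∧
      ∫ ω, h (x (τ ω) ω) ∂P = ((S : ℝ) + 1)⁻¹ * ∑ s ∈ Finset.range (S + 1), ∫ ω, h (x s ω) ∂P := by
  set u : ℕ → ℕ → ℝ := fun s t => if t = s then 1 else 0 with hu
  have hu_meas : ∀ s, Measurable fun ω => u s (τ ω) := fun s =>
    (measurable_of_countable (u s)).comp hrun.measurable_index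
  have hx' : ∀ s ∈ Finset.range (S + 1), Measurable fun ω => h (x s ω) := fun s hs =>
    hh.comp (hx s (Finset.mem_range_succ_iff.1 hs))
  have e : (fun ω => h (x (τ ω) ω)) = fun ω =>
      ∑ s ∈ Finset.range (S + 1), u s (τ ω) * h (x s ω) := by
    ext1 ω
    rw [Finset.sum_eq_single_of_mem (τ ω) (Finset.mem_range_succ_iff.2 (hrun.index_mem ω))]
    · simp [hu]
    · intro s _ hs
      simp [hu, hs.symm]
  have hint : ∀ s ∈ Finset.range (S + 1), Integrable (fun ω => u s (τ ω) * h (x s ω)) P :=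
    fun s hs => Integrable.of_bound ((hu_meas s).mul (hx' s hs)).aestronglyMeasurable C
      (Filter.Eventually.of_forall fun ω => by
        have h0 := hC (x s ω)
        by_cases hτ : τ ω = s
        · simpa [hu, hτ] using h0
        · simpa [hu, hτ] using (abs_nonneg _).trans h0)
  refine ⟨by rw [e]; exact integrable_finsetSum _ hint, ?_⟩
  rw [e, integral_finsetSum _ hint, Finset.mul_sum]
  refine Finset.sum_congr rfl fun s hs => ?_
  have hs' := Finset.mem_range_succ_iff.1 hs
  -- Splitting by the value of `τ` turns the randomly indexed iterate into products of an indicator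
  -- and a fixed iterate, which factor by independence.
  have hind : IndepFun (fun ω => u s (τ ω)) (fun ω => h (x s ω)) P :=
    hrun.index_indep.comp (measurable_of_countable (u s))
      (hh.comp (measurable_pi_apply (⟨s, Nat.lt_succ_of_le hs'⟩ : Fin (S + 1))))
  rw [hind.integral_fun_mul_eq_mul_integral (hu_meas s).aestronglyMeasurable
    (hx' s hs).aestronglyMeasurable]
  congr 1
  have hset : MeasurableSet {ω | τ ω = s} := hrun.measurable_index (measurableSet_singleton s)
  have e2 : (fun ω => u s (τ ω)) = Set.indicator {ω | τ ω = s} 1 := by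
    ext ω; simp [hu, Set.indicator]
  rw [e2, integral_indicator_one hset, measureReal_def, hrun.index_uniform s hs',
    ENNReal.toReal_inv, ENNReal.toReal_add (by simp) (by simp)]
  simp

end Convergence

/-- This η makes the accumulated noise term equal to the telescoped term 2B, so ηT ≤ 8B. Squaring 8B
≤ ηε²(S + 1) gives 32BKM² ≤ ε⁴(S + 1), the source of the constant 32. -/
lemma average_le_of_stepsize {B K M ε η T : ℝ} {S : ℕ} (hB : 0 < B) (hK : 0 < K) (hM : 0 < M)
    (hε : 0 < ε) (hS : 32 * B * K * M ^ 2 * (ε ^ 4)⁻¹ ≤ (S : ℝ))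
    (hη : η = Real.sqrt (2 * B / (K * M ^ 2 * ((S : ℝ) + 1))))
    (hT : η / 2 * T ≤ 2 * B + (S + 1) * (K * η ^ 2 * M ^ 2)) :
    ((S : ℝ) + 1)⁻¹ * T ≤ ε ^ 2 := by
  have hS1 : (0 : ℝ) < (S : ℝ) + 1 := by positivity
  have hη2 : η ^ 2 = 2 * B / (K * M ^ 2 * ((S : ℝ) + 1)) := by
    rw [hη, Real.sq_sqrt (by positivity)]
  have hη0 : 0 < η := hη ▸ Real.sqrt_pos.2 (by positivity)
  have e1 : (S + 1) * (K * η ^ 2 * M ^ 2) = 2 * B := by rw [hη2]; field_simp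
  rw [e1] at hT
  have hS' : 32 * B * K * M ^ 2 ≤ ε ^ 4 * (S + 1) := by
    rw [← div_eq_mul_inv, div_le_iff₀ (by positivity)] at hS
    nlinarith [pow_pos hε 4]
  have h8 : 8 * B ≤ η * (ε ^ 2 * (S + 1)) := by
    refine abs_le_of_sq_le_sq' ?_ (by positivity) |>.2
    rw [mul_pow, mul_pow η, hη2, div_mul_eq_mul_div, le_div_iff₀ (by positivity)]
    nlinarith [mul_le_mul_of_nonneg_left hS' (show 0 ≤ 2 * B * (S + 1) by positivity)]
  rw [inv_mul_le_iff₀ hS1, mul_comm]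
  refine le_of_mul_le_mul_left ?_ hη0
  linarith

end MinimaxSGD

end

theorem theorem1 {d₁ d₂ l k : ℕ} (hk : 0 < k)
    (f : MinimaxSGD.EProd d₁ d₂ → ℝ)
    (A : Fin k → MinimaxSGD.E d₁ → MinimaxSGD.E l → MinimaxSGD.E d₂)
    (ν : Fin k → Measure (MinimaxSGD.E l)) [∀ i, IsProbabilityMeasure (ν i)]
    (B G L ρ G' L' : ℝ)
    (hf : MinimaxSGD.SmoothObjective f B G L ρ)
    (hA : ∀ i, MinimaxSGD.SmoothAlgorithm (A i) G' L')
    (hA_meas : ∀ i x, Measurable (A i x))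
    (Lhat Ghat : ℝ)
    (hLhat : Lhat = L * (1 + G') ^ 2 + G * L') (hGhat : Ghat = G * (1 + G'))
    (hLhat_pos : 0 < Lhat) (hGhat_pos : 0 < Ghat)
    (ε : ℝ) (hε : 0 < ε) (S : ℕ)
    (hS : 32 * B * Lhat * Ghat ^ 2 * (ε ^ 4)⁻¹ ≤ (S : ℝ))
    (η : ℝ) (hη : η = Real.sqrt (2 * B / (Lhat * Ghat ^ 2 * ((S : ℝ) + 1))))
    {Ω : Type*} [MeasurableSpace Ω] (P : Measure Ω) [IsProbabilityMeasure P]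
    (x₀ : MinimaxSGD.E d₁)
    (z : ℕ → Ω → Fin k → MinimaxSGD.E l) (c : ℕ → Ω → Fin k → ℝ)
    (x : ℕ → Ω → MinimaxSGD.E d₁) (τ : Ω → ℕ)
    (hrun : MinimaxSGD.IsSGDRun P f A ν S x₀ η z c x τ) :
    -- the minimum defining the Moreau envelope is attained
    (∀ u, IsLeast
      (Set.range fun u' => MinimaxSGD.robustObj f A ν u' + Lhat * ‖u - u'‖ ^ 2)
      (MinimaxSGD.moreauEnvelope (MinimaxSGD.robustObj f A ν) (1 / (2 * Lhat)) u)) ∧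
    -- the Moreau envelope is differentiable
    Differentiable ℝ
      (MinimaxSGD.moreauEnvelope (MinimaxSGD.robustObj f A ν) (1 / (2 * Lhat))) ∧
    -- the expectation exists, and is at most `ε ^ 2`
    Integrable (fun ω => ‖gradient
      (MinimaxSGD.moreauEnvelope (MinimaxSGD.robustObj f A ν) (1 / (2 * Lhat)))
        (x (τ ω) ω)‖ ^ 2) P ∧
    ∫ ω, ‖gradient
      (MinimaxSGD.moreauEnvelope (MinimaxSGD.robustObj f A ν) (1 / (2 * Lhat)))
        (x (τ ω) ω)‖ ^ 2 ∂P ≤ ε ^ 2 := by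
  have : NeZero k := ⟨hk.ne'⟩
  subst hGhat
  have hg := MinimaxSGD.continuous_robustObj (ν := ν) hf hA hA_meas
  have hB := MinimaxSGD.abs_robustObj_le (A := A) (ν := ν) hf
  have hB' : ∀ u, -B ≤ MinimaxSGD.robustObj f A ν u := fun u => (abs_le.1 (hB u)).1
  have hgc : StrongConvexOn Set.univ (-Lhat) (MinimaxSGD.robustObj f A ν) :=
    hLhat ▸ MinimaxSGD.strongConvexOn_robustObj hf hA hA_meas
  have hbound := MinimaxSGD.sq_norm_gradient_moreauEnvelope_le hg hB hLhat_pos hgc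
  have hη0 : 0 ≤ η := hη ▸ Real.sqrt_nonneg _
  obtain ⟨hint, hout⟩ := hrun.integral_output
    (fun s hs => hrun.measurable_iterate hf hA hA_meas (by omega))
    (h := fun u => ‖gradient
      (MinimaxSGD.moreauEnvelope (MinimaxSGD.robustObj f A ν) (1 / (2 * Lhat))) u‖ ^ 2)
    ((MinimaxSGD.measurable_gradient _).norm.pow_const 2)
    (fun u => by rw [abs_of_nonneg (sq_nonneg _)]; exact hbound u)
  refine ⟨fun u => ?_, fun u => ?_, hint, ?_⟩
  · obtain ⟨p, hp⟩ := MinimaxSGD.exists_prox hg hB' hLhat_pos u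
    exact (MinimaxSGD.isLeast_moreauEnvelope hLhat_pos hp).1
  · obtain ⟨p, hp⟩ := MinimaxSGD.exists_prox hg hB' hLhat_pos u
    exact (MinimaxSGD.hasGradientAt_moreauEnvelope hg hB' hLhat_pos hgc hp).differentiableAt
  -- If B = 0 then η = 0 and one cannot divide by it, but the uniform bound 8KB on the squared
  -- gradient already vanishes.
  · rcases ((abs_nonneg _).trans (hf.bounded 0)).eq_or_lt with h0 | h0
    · refine (integral_mono hint (integrable_const (8 * Lhat * B)) fun ω => hbound _).trans ?_
      simp [← h0, sq_nonneg]
    · rw [hout]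
      exact MinimaxSGD.average_le_of_stepsize h0 hLhat_pos hGhat_pos hε hS hη
        (hrun.sum_integral_sq_norm_gradient_le hf hA hA_meas hLhat hLhat_pos hGhat_pos hη0)
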